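/- Let $\mathcal H=\mathbb C^2\otimes\mathbb C^2\otimes\mathbb C^2$ and $$|\Phi\rangle=\tfrac1{\sqrt3}\bigl(|000\rangle+|110\rangle+|201\rangle\bigr)\in\mathcal H'=\mathbb C^3\otimes\mathbb C^2\otimes\mathbb C^2 .$$ Regard $\mathcal H'\otimes\mathcal H$ as a tripartite system, the $k$-th party holding the $k$-th factor of $\mathcal H'$ and the $k$-th factor of $\mathcal H$. An LOCC measurement is a POVM implemented by a protocol with finitely many rounds of local measurements (with finitely many outcomes) and classical communication. States $\chi_1,\dots,\chi_n$ are unambiguously distinguished by LOCC if there is an LOCC measurement $\Pi_1,\dots,\Pi_n,\Pi_{n+1}$ (outcome $n+1$ being inconclusive) and constants $\epsilon_i>0$ with $\langle\chi_j|\Pi_i|\chi_j\rangle=\delta_{ij}\epsilon_i$ for all $i,j\le n$; they are perfectly distinguished if this holds with all $\epsilon_i=1$. Call a state of $\mathcal H$ a $W$ state (respectively a $GHZ$ state) if it is the image of $|W\rangle=\frac1{\sqrt3}(|100\rangle+|010\rangle+|001\rangle)$ (respectively of $|GHZ\rangle=\frac1{\sqrt2}(|000\rangle+|111\rangle)$)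 under a local unitary $U_1\otimes U_2\otimes U_3$. Then: 1. $|\Phi\rangle$ is universal for local unambiguous discrimination in $\mathcal H$: for every linearly independent family of unit vectors $|\psi_1\rangle,\dots,|\psi_n\rangle$ in $\mathcal H$, the states $|\Phi\rangle\otimes|\psi_i\rangle$ can be unambiguously distinguished by LOCC. 2. $|\Phi\rangle$ is not universal for local (perfect) state discrimination in $\mathcal H$: it is not true that for every orthonormal family $|\psi_1\rangle,\dots,|\psi_n\rangle$ in $\mathcal H$ the states $|\Phi\rangle\otimes|\psi_i\rangle$ can be perfectly distinguished by LOCC. 3. If $|\psi_1\rangle,\dots,|\psi_8\rangle$ is any basis of $\mathcal H$ that consists of $W$ states and $GHZ$ states and contains at least one $GHZ$ state, then the states $|\Phi\rangle\otimes|\psi_i\rangle$ cannot be perfectly distinguished by LOCC, nor by any limit of LOCC measurements (so allowing infinitely many rounds does not help). -/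

import Mathlib

noncomputable section

namespace LocalDiscrimination

/-- The Hilbert space `⊗ₖ ℂ^{d k}` of an `N`-partite system, written in its standard product basis:
the basis is indexed by the tuples `x` with `x k ∈ {0, …, d k - 1}`. -/
abbrev Sys {N : ℕ} (d : Fin N → ℕ) : Type :=
  EuclideanSpace ℂ (∀ k, Fin (d k))

/-- Operators on `⊗ₖ ℂ^{d k}`, as matrices in the standard product basis. -/
abbrev Op {N : ℕ} (d : Fin N → ℕ) : Type :=
  Matrix (∀ k, Fin (d k)) (∀ k, Fin (d k)) ℂ

/-- The standard product basis vector `|a₁ a₂ … a_N⟩` (used only with `a k < d k`). -/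
def ket {N : ℕ} (d : Fin N → ℕ) (a : Fin N → ℕ) : Sys d :=
  WithLp.toLp 2 fun x => if ∀ k, (x k : ℕ) = a k then 1 else 0

/-- The product operator `A₁ ⊗ ⋯ ⊗ A_N`. -/
def tensorOp {N : ℕ} {d e : Fin N → ℕ} (A : ∀ k, Matrix (Fin (e k)) (Fin (d k)) ℂ) :
    Matrix (∀ k, Fin (e k)) (∀ k, Fin (d k)) ℂ :=
  Matrix.of fun y x => ∏ k, A k (y k) (x k)

/-- The vector `Φ ⊗ ψ` of `H' ⊗ H`, regarded as an `N`-partite system whose `k`-th local space is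
`ℂ^{d' k} ⊗ ℂ^{d k} = ℂ^{d' k * d k}` (basis vector `|a⟩ ⊗ |b⟩` has number `a * d k + b`). -/
def tensorState {N : ℕ} {d' d : Fin N → ℕ} (Φ : Sys d') (ψ : Sys d) :
    Sys (fun k => d' k * d k) :=
  WithLp.toLp 2 fun x => Φ (fun k => (x k).divNat) * ψ (fun k => (x k).modNat)

/-- The number `⟨v|M|v⟩`. -/
def expect {N : ℕ} {d : Fin N → ℕ} (M : Op d) (v : Sys d) : ℂ :=
  dotProduct (star v.ofLp) (M.mulVec v.ofLp)

/-- LOCC protocols with finitely many rounds on `⊗ₖ ℂ^{d k}` that end by announcing an element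
of `O`. In a round one party `k` performs a local measurement with finitely many outcomes `j` and
Kraus operators `K j k`, and makes `j` public; each other party `i` then applies a local isometry
`K j i` (for instance the identity, a unitary, or the addition of an ancilla) that may depend on
`j`. The rest of the protocol may depend on `j`, and local dimensions may change from `d` to `e j`.
Local randomness is the case of Kraus operators that are multiples of the identity. -/
inductive Protocol (N : ℕ) (O : Type) : (Fin N → ℕ) → Type
  | announce {d : Fin N → ℕ} (o : O) : Protocol N O d
  | round {d : Fin N → ℕ} (k : Fin N) (m : ℕ) (e : Fin m → Fin N → ℕ)
      (K : ∀ (j : Fin m) (i : Fin N), Matrix (Fin (e j i)) (Fin (d i)) ℂ)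
      (measurement : ∑ j, (K j k).conjTranspose * K j k = 1)
      (isometry : ∀ j, ∀ i, i ≠ k → (K j i).conjTranspose * K j i = 1)
      (next : ∀ j, Protocol N O (e j)) : Protocol N O d

/-- The POVM element of the outcome `o` of a protocol: the sum of `L† L` over all branches that
announce `o`, where `L` is the product of the Kraus operators along the branch. -/
def Protocol.effect {N : ℕ} {O : Type} [DecidableEq O] :
    {d : Fin N → ℕ} → Protocol N O d → O → Op d
  | _, .announce o', o => if o = o' then 1 else 0
  | _, .round _ _ _ K _ _ next, o =>
      ∑ j, (tensorOp (K j)).conjTranspose * (next j).effect o * tensorOp (K j)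

/-- A family of operators indexed by `O` is an LOCC measurement. -/
def IsLOCCMeasurement {N : ℕ} {O : Type} [DecidableEq O] {d : Fin N → ℕ} (M : O → Op d) : Prop :=
  ∃ P : Protocol N O d, ∀ o, M o = P.effect o

/-- On the states `χ₁, …, χₙ`, the measurement `M` (with outcomes `some 1, …, some n` and the
inconclusive outcome `none`) identifies `χᵢ` with probability `ε i` and never errs. -/
def Identifies {N n : ℕ} {d : Fin N → ℕ} (M : Option (Fin n) → Op d) (χ : Fin n → Sys d)
    (ε : Fin n → ℝ) : Prop :=
  ∀ i j, expect (M (some i)) (χ j) = if i = j then (ε i : ℂ) else 0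

/-- The states can be perfectly distinguished with LOCC. -/
def PerfectlyDistinguishable {N n : ℕ} {d : Fin N → ℕ} (χ : Fin n → Sys d) : Prop :=
  ∃ M : Option (Fin n) → Op d, IsLOCCMeasurement M ∧ Identifies M χ (fun _ => 1)

/-- The states can be unambiguously distinguished with LOCC. -/
def UnambiguouslyDistinguishable {N n : ℕ} {d : Fin N → ℕ} (χ : Fin n → Sys d) : Prop :=
  ∃ M : Option (Fin n) → Op d, IsLOCCMeasurement M ∧
    ∃ ε : Fin n → ℝ, (∀ i, 0 < ε i) ∧ Identifies M χ ε

/-- `Φ` is universal for local (perfect) state discrimination in `⊗ₖ ℂ^{d k}`. -/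
def UniversalPerfect {N : ℕ} {d' : Fin N → ℕ} (Φ : Sys d') (d : Fin N → ℕ) : Prop :=
  ∀ (n : ℕ) (ψ : Fin n → Sys d), Orthonormal ℂ ψ →
    PerfectlyDistinguishable (fun i => tensorState Φ (ψ i))

/-- `Φ` is universal for local unambiguous discrimination in `⊗ₖ ℂ^{d k}`. -/
def UniversalUnambiguous {N : ℕ} {d' : Fin N → ℕ} (Φ : Sys d') (d : Fin N → ℕ) : Prop :=
  ∀ (n : ℕ) (ψ : Fin n → Sys d), (∀ i, ‖ψ i‖ = 1) → LinearIndependent ℂ ψ →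
    UnambiguouslyDistinguishable (fun i => tensorState Φ (ψ i))

/-- Local dimensions of three qubits. -/
abbrev qubits : Fin 3 → ℕ := fun _ => 2

/-- `|W⟩ = (|100⟩ + |010⟩ + |001⟩)/√3`. -/
def W : Sys qubits :=
  ((Real.sqrt 3 : ℂ)⁻¹) • (ket qubits ![1, 0, 0] + ket qubits ![0, 1, 0] + ket qubits ![0, 0, 1])

/-- `|GHZ⟩ = (|000⟩ + |111⟩)/√2`. -/
def GHZ : Sys qubits :=
  ((Real.sqrt 2 : ℂ)⁻¹) • (ket qubits ![0, 0, 0] + ket qubits ![1, 1, 1])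

/-- `φ = (U₁ ⊗ U₂ ⊗ U₃) ψ` for some unitaries `U₁, U₂, U₃`. -/
def LocalUnitaryEquiv (ψ φ : Sys qubits) : Prop :=
  ∃ U : Fin 3 → Matrix (Fin 2) (Fin 2) ℂ, (∀ k, U k ∈ Matrix.unitaryGroup (Fin 2) ℂ) ∧
    φ.ofLp = (tensorOp (d := qubits) (e := qubits) U).mulVec ψ.ofLp

/-- `W` states: the states with the same entanglement as `|W⟩`. -/
def IsWState (ψ : Sys qubits) : Prop := LocalUnitaryEquiv W ψ

/-- `GHZ` states: the states with the same entanglement as `|GHZ⟩`. -/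
def IsGHZState (ψ : Sys qubits) : Prop := LocalUnitaryEquiv GHZ ψ

/-- The resource `(|000⟩ + |110⟩ + |201⟩)/√3` in `ℂ³ ⊗ ℂ² ⊗ ℂ²`. -/
def resource : Sys ![3, 2, 2] :=
  ((Real.sqrt 3 : ℂ)⁻¹) •
    (ket ![3, 2, 2] ![0, 0, 0] + ket ![3, 2, 2] ![1, 1, 0] + ket ![3, 2, 2] ![2, 0, 1])

end LocalDiscrimination

end

/-! Unambiguous discrimination: every tensor in ℂ²⊗ℂ²⊗ℂ² is an image of the resource Φ under local
linear maps (`exists_local_image`). Dually, every linear functional on three qubits is ψ ↦ ⟨a|Φ⊗ψ⟩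
for a product vector a (`exists_productVector`). For the functionals dual to a linearly independent
family this gives product vectors aᵢ orthogonal to Φ⊗ψⱼ exactly when j ≠ i; the parties pick i at
random and test for aᵢ factor by factor.

Perfect discrimination: LOCC is relaxed to POVMs whose elements have positive partial transpose Γ at
the second party (index 1). This class is closed, so it contains all limits of LOCC measurements.
Put V : ψ ↦ Φ⊗ψ. Perfect discrimination of a basis forces V†MᵢV = |bᵢ⟩⟨bᵢ|, whose partial transpose
takes the value -1/2 (GHZ) or -√2/3 (W) at some unit vector. On the other hand |Φ⟩⟨Φ|^Γ is a
positive part minus one rank-one term, which bounds this negativity by a nonnegative number Tᵢ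
linear in Mᵢ (`negativity_attach_le`). As the Mᵢ add up to 1, the Tᵢ add up to 8·√2/3
(`sum_trace_resourceNegative`): just enough for eight W states, too little once a GHZ state occurs,
because 1/2 > √2/3. An orthonormal basis of GHZ states refutes universality. -/

open scoped ComplexOrder
open Matrix

namespace LocalDiscrimination

/-! ### Product operators and partial transposition. -/

section ProductOperators

variable {N : ℕ} {d e f : Fin N → ℕ}

lemma tensorOp_mul (A : ∀ k, Matrix (Fin (f k)) (Fin (e k)) ℂ)
    (B : ∀ k, Matrix (Fin (e k)) (Fin (d k)) ℂ) :
    tensorOp A * tensorOp B = tensorOp fun k => A k * B k := by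
  ext x y
  simp [tensorOp, mul_apply, Finset.prod_univ_sum, Fintype.piFinset_univ, Finset.prod_mul_distrib]

lemma conjTranspose_tensorOp (A : ∀ k, Matrix (Fin (e k)) (Fin (d k)) ℂ) :
    (tensorOp A)ᴴ = tensorOp fun k => (A k)ᴴ := by
  ext x y
  simp [tensorOp, conjTranspose_apply]

lemma tensorOp_one : tensorOp (fun k => (1 : Matrix (Fin (d k)) (Fin (d k)) ℂ)) = 1 := by
  ext x y
  simp only [tensorOp, of_apply, one_apply, Finset.prod_ite_zero, Finset.prod_const_one,
    Finset.mem_univ, true_imp_iff, funext_iff]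

lemma tensorOp_update_apply (A : ∀ k, Matrix (Fin (e k)) (Fin (d k)) ℂ) (k : Fin N)
    (B : Matrix (Fin (e k)) (Fin (d k)) ℂ) (x : ∀ k, Fin (e k)) (y : ∀ k, Fin (d k)) :
    tensorOp (Function.update A k B) x y =
      B (x k) (y k) * ∏ i ∈ Finset.univ.erase k, A i (x i) (y i) := by
  rw [tensorOp, of_apply, ← Finset.mul_prod_erase _ _ (Finset.mem_univ k)]
  congr 1
  · simp
  · refine Finset.prod_congr rfl fun i hi => ?_
    rw [Function.update_of_ne (Finset.ne_of_mem_erase hi)]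

lemma sum_tensorOp_update {m : ℕ} (A : ∀ k, Matrix (Fin (e k)) (Fin (d k)) ℂ) (k : Fin N)
    (B : Fin m → Matrix (Fin (e k)) (Fin (d k)) ℂ) :
    ∑ j, tensorOp (Function.update A k (B j)) = tensorOp (Function.update A k (∑ j, B j)) := by
  ext x y
  simp only [Matrix.sum_apply, tensorOp_update_apply, Finset.sum_mul]

end ProductOperators

section PartialTranspose

/-- The partial transpose with respect to party `k`. -/
def partialTranspose {N : ℕ} {d : Fin N → ℕ} (k : Fin N) (M : Op d) : Op d :=
  of fun x y => M (Function.update x k (y k)) (Function.update y k (x k))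

/-- Exchange of the `k`-th components of two tuples. -/
def swapAt {N : ℕ} (d : Fin N → ℕ) (k : Fin N) :
    (∀ i, Fin (d i)) × (∀ i, Fin (d i)) ≃ (∀ i, Fin (d i)) × (∀ i, Fin (d i)) where
  toFun p := (Function.update p.1 k (p.2 k), Function.update p.2 k (p.1 k))
  invFun p := (Function.update p.1 k (p.2 k), Function.update p.2 k (p.1 k))
  left_inv p := by simp
  right_inv p := by simp

variable {N : ℕ} {d e : Fin N → ℕ}

lemma sum_sum_swapAt (k : Fin N) (F : (∀ i, Fin (d i)) → (∀ i, Fin (d i)) → ℂ) :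
    ∑ a, ∑ b, F (Function.update a k (b k)) (Function.update b k (a k)) = ∑ a, ∑ b, F a b := by
  simp only [← Fintype.sum_prod_type']
  exact Equiv.sum_comp (swapAt d k) fun p => F p.1 p.2

lemma partialTranspose_sum {ι : Type*} (s : Finset ι) (k : Fin N) (M : ι → Op d) :
    partialTranspose k (∑ i ∈ s, M i) = ∑ i ∈ s, partialTranspose k (M i) := by
  ext x y
  simp [partialTranspose, Matrix.sum_apply]

lemma partialTranspose_one (k : Fin N) : partialTranspose k (1 : Op d) = 1 := by
  ext x y
  have : Function.update x k (y k) = Function.update y k (x k) ↔ x = y := by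
    constructor
    · intro h
      funext i
      have := congrFun h i
      by_cases hi : i = k
      · subst hi; simpa using this.symm
      · simpa [hi] using this
    · rintro rfl; rfl
  simp [partialTranspose, one_apply, this]

/-- Entrywise complex conjugation of the `k`-th factor. -/
def conjAt (k : Fin N) (K : ∀ i, Matrix (Fin (e i)) (Fin (d i)) ℂ) :
    ∀ i, Matrix (Fin (e i)) (Fin (d i)) ℂ :=
  Function.update K k ((K k).map star)

lemma triple_product_apply {m n : Type*} [Fintype m] (A : Matrix m n ℂ) (M : Matrix m m ℂ)
    (x y : n) : (Aᴴ * M * A) x y = ∑ a, ∑ b, star (A a x) * M a b * A b y := by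
  simp only [mul_apply, conjTranspose_apply, Finset.sum_mul]
  exact Finset.sum_comm

/-- Exchanging the `k`-th components of the two summation indices swaps the two `k`-th entries of
`K`; the only trace left is that each is conjugated. -/
lemma partialTranspose_conj (k : Fin N) (K : ∀ i, Matrix (Fin (e i)) (Fin (d i)) ℂ) (M : Op e) :
    partialTranspose k ((tensorOp K)ᴴ * M * tensorOp K) =
      (tensorOp (conjAt k K))ᴴ * partialTranspose k M * tensorOp (conjAt k K) := by
  ext x y
  rw [partialTranspose, of_apply, triple_product_apply, triple_product_apply,
    ← sum_sum_swapAt k]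
  refine Finset.sum_congr rfl fun a _ => Finset.sum_congr rfl fun b _ => ?_
  have hs (u v : ∀ i, Fin (e i)) (w z : ∀ i, Fin (d i)) :
      tensorOp K (Function.update u k (v k)) (Function.update w k (z k)) =
        K k (v k) (z k) * ∏ i ∈ Finset.univ.erase k, K i (u i) (w i) := by
    rw [tensorOp, of_apply, ← Finset.mul_prod_erase _ _ (Finset.mem_univ k)]
    congr 1
    · simp
    · refine Finset.prod_congr rfl fun i hi => ?_
      rw [Function.update_of_ne (Finset.ne_of_mem_erase hi),
        Function.update_of_ne (Finset.ne_of_mem_erase hi)]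
  rw [hs, hs, conjAt, tensorOp_update_apply, tensorOp_update_apply, partialTranspose, of_apply]
  simp only [map_apply, star_mul', star_star]
  ring

lemma conjAt_unitary {k : Fin N} {U : ∀ i, Matrix (Fin (d i)) (Fin (d i)) ℂ}
    (hU : ∀ i, (U i)ᴴ * U i = 1) : (tensorOp (conjAt k U))ᴴ * tensorOp (conjAt k U) = 1 := by
  rw [conjTranspose_tensorOp, tensorOp_mul, ← tensorOp_one]
  congr 1
  ext1 i
  by_cases hi : i = k
  · subst hi
    have h : (U i).map star = ((U i)ᴴ)ᵀ := by ext; simp [conjTranspose_apply]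
    have h2 : ((U i)ᴴᵀ)ᴴ = (U i)ᵀ := by ext; simp [conjTranspose_apply]
    simp only [conjAt, Function.update_self, h, h2]
    rw [← transpose_mul, hU, transpose_one]
  · simp [conjAt, hi, hU]

end PartialTranspose

/-! ### LOCC measurements and their limits have positive partial transpose. -/

section PPT

variable {N : ℕ} {O : Type} {d : Fin N → ℕ}

/-- The measurement `M` is a POVM whose elements have positive partial transpose with respect to
party `k`. -/
structure IsPPTMeasurement [Fintype O] (k : Fin N) (M : O → Op d) : Prop where
  posSemidef : ∀ o, (M o).PosSemidef
  ppt : ∀ o, (partialTranspose k (M o)).PosSemidef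
  sum_eq_one : ∑ o, M o = 1

lemma Protocol.effect_posSemidef [DecidableEq O] (P : Protocol N O d) (o : O) : (P.effect o).PosSemidef := by
  induction P with
  | announce o' =>
    rw [Protocol.effect]
    split_ifs
    · exact PosSemidef.one
    · exact PosSemidef.zero
  | round k m e K hK hi next ih =>
    rw [Protocol.effect]
    exact posSemidef_sum _ fun j _ => (ih j).conjTranspose_mul_mul_same _

/-- By `partialTranspose_conj`, a round acts on partial transposes as a sum of congruences, which
preserves positivity. -/
lemma Protocol.effect_ppt [DecidableEq O] (P : Protocol N O d) (k : Fin N) (o : O) :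
    (partialTranspose k (P.effect o)).PosSemidef := by
  induction P with
  | announce o' =>
    rw [Protocol.effect]
    split_ifs
    · rw [partialTranspose_one]; exact PosSemidef.one
    · exact PosSemidef.zero
  | round k' m e K hK hi next ih =>
    rw [Protocol.effect, partialTranspose_sum]
    refine posSemidef_sum _ fun j _ => ?_
    rw [partialTranspose_conj]
    exact (ih j).conjTranspose_mul_mul_same _

lemma Protocol.sum_effect [DecidableEq O] [Fintype O] (P : Protocol N O d) : ∑ o, P.effect o = 1 := by
  induction P with
  | announce o' => simp [Protocol.effect]
  | round k m e K hK hi next ih =>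
    simp only [Protocol.effect]
    rw [Finset.sum_comm]
    -- The isometries of the other parties cancel in K†K, leaving the identity away from party `k`.
    have h (j : Fin m) : (fun i => (K j i)ᴴ * K j i) =
        Function.update (fun i => 1) k ((K j k)ᴴ * K j k) := by
      ext1 i
      by_cases h : i = k
      · subst h; simp
      · simp [h, hi j i h]
    have hj (j : Fin m) :
        ∑ o, (tensorOp (K j))ᴴ * (next j).effect o * tensorOp (K j) =
          tensorOp (Function.update (fun i => 1) k ((K j k)ᴴ * K j k)) := by
      rw [← Matrix.sum_mul, ← Matrix.mul_sum, ih, Matrix.mul_one, conjTranspose_tensorOp, tensorOp_mul, h]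
    simp only [hj]
    rw [← tensorOp_one, sum_tensorOp_update, hK]
    congr 1
    exact Function.update_eq_self k _

lemma IsLOCCMeasurement.isPPTMeasurement [DecidableEq O] [Fintype O] {M : O → Op d} (h : IsLOCCMeasurement M)
    (k : Fin N) : IsPPTMeasurement k M := by
  obtain ⟨P, hP⟩ := h
  obtain rfl : M = P.effect := funext hP
  exact ⟨P.effect_posSemidef, P.effect_ppt k, P.sum_effect⟩

lemma isClosed_posSemidef {n : Type*} [Fintype n] : IsClosed {M : Matrix n n ℂ | M.PosSemidef} := by
  simp only [posSemidef_iff_dotProduct_mulVec, Set.ofPred_and, Set.ofPred_forall]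
  refine IsClosed.inter (isClosed_eq (by fun_prop) continuous_id) (isClosed_iInter fun v => ?_)
  exact isClosed_le continuous_const (by fun_prop)

lemma isClosed_isPPTMeasurement [Fintype O] (k : Fin N) :
    IsClosed {M : O → Op d | IsPPTMeasurement k M} := by
  have h : {M : O → Op d | IsPPTMeasurement k M} =
      (⋂ o, {M | (M o).PosSemidef}) ∩ (⋂ o, {M | (partialTranspose k (M o)).PosSemidef}) ∩
        {M | ∑ o, M o = 1} := by
    ext M
    simp only [Set.mem_inter_iff, Set.mem_iInter, Set.mem_ofPred_eq]
    exact ⟨fun h => ⟨⟨h.1, h.2⟩, h.3⟩, fun h => ⟨h.1.1, h.1.2, h.2⟩⟩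
  rw [h]
  have hc : Continuous (partialTranspose k : Op d → Op d) :=
    continuous_pi fun x => continuous_pi fun y => continuous_apply_apply _ _
  refine ((isClosed_iInter fun o => ?_).inter (isClosed_iInter fun o => ?_)).inter
    (isClosed_eq (by fun_prop) continuous_const)
  · exact isClosed_posSemidef.preimage (continuous_apply (A := fun _ : O => Op d) o)
  · exact isClosed_posSemidef.preimage (hc.comp (continuous_apply (A := fun _ : O => Op d) o))

lemma isPPTMeasurement_of_mem_closure [DecidableEq O] [Fintype O] {M : O → Op d} (k : Fin N)
    (hM : M ∈ closure {M : O → Op d | IsLOCCMeasurement M}) : IsPPTMeasurement k M :=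
  closure_minimal (fun _ h => h.isPPTMeasurement k) (isClosed_isPPTMeasurement k) hM

end PPT

/-! ### Attaching a resource state. -/

section Attach

variable {N : ℕ} {d' d : Fin N → ℕ}

/-- The index of `|a⟩ ⊗ |b⟩`, party by party. -/
def pairEquiv (d' d : Fin N → ℕ) :
    (∀ k, Fin (d' k)) × (∀ k, Fin (d k)) ≃ ∀ k, Fin (d' k * d k) where
  toFun p k := finProdFinEquiv (p.1 k, p.2 k)
  invFun x := (fun k => (x k).divNat, fun k => (x k).modNat)
  left_inv p := Prod.ext (funext fun k => congrArg Prod.fst (finProdFinEquiv.left_inv (p.1 k, p.2 k)))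
    (funext fun k => congrArg Prod.snd (finProdFinEquiv.left_inv (p.1 k, p.2 k)))
  right_inv x := funext fun k => finProdFinEquiv.right_inv (x k)

lemma update_pairEquiv (k : Fin N) (a b : ∀ k, Fin (d' k)) (x y : ∀ k, Fin (d k)) :
    Function.update (pairEquiv d' d (a, x)) k (pairEquiv d' d (b, y) k) =
      pairEquiv d' d (Function.update a k (b k), Function.update x k (y k)) := by
  funext i
  by_cases hi : i = k
  · subst hi; simp [pairEquiv]
  · simp [pairEquiv, hi]

lemma sum_pairEquiv (F : (∀ k, Fin (d' k * d k)) → ℂ) :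
    ∑ x, F x = ∑ a, ∑ b, F (pairEquiv d' d (a, b)) := by
  rw [← Fintype.sum_prod_type', Equiv.sum_comp (pairEquiv d' d)]

/-- The isometry (up to a factor) `ψ ↦ Φ ⊗ ψ`. -/
def attach (d : Fin N → ℕ) (Φ : (∀ k, Fin (d' k)) → ℂ) :
    Matrix (∀ k, Fin (d' k * d k)) (∀ k, Fin (d k)) ℂ :=
  of fun x y => Φ ((pairEquiv d' d).symm x).1 * if ((pairEquiv d' d).symm x).2 = y then 1 else 0

lemma attach_pairEquiv (Φ : (∀ k, Fin (d' k)) → ℂ) (a : ∀ k, Fin (d' k)) (x y : ∀ k, Fin (d k)) :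
    attach d Φ (pairEquiv d' d (a, x)) y = Φ a * if x = y then 1 else 0 := by
  simp [attach]

lemma attach_mulVec (Φ : Sys d') (ψ : Sys d) :
    attach d Φ.ofLp *ᵥ ψ.ofLp = (tensorState Φ ψ).ofLp := by
  funext x
  simp only [mulVec, dotProduct, attach, of_apply, mul_ite, mul_one, mul_zero, ite_mul, zero_mul,
    Finset.sum_ite_eq, Finset.mem_univ, if_true]
  rfl

lemma attach_conj_apply (Φ : (∀ k, Fin (d' k)) → ℂ) (M : Op fun k => d' k * d k)
    (x y : ∀ k, Fin (d k)) :
    ((attach d Φ)ᴴ * M * attach d Φ) x y =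
      ∑ a, ∑ b, star (Φ a) * M (pairEquiv d' d (a, x)) (pairEquiv d' d (b, y)) * Φ b := by
  rw [triple_product_apply]
  simp only [sum_pairEquiv, attach_pairEquiv]
  refine Finset.sum_congr rfl fun a _ => ?_
  rw [Finset.sum_eq_single x (fun b _ hb => by simp [hb]) (by simp)]
  refine Finset.sum_congr rfl fun b _ => ?_
  rw [Finset.sum_eq_single y (fun b _ hb => by simp [hb]) (by simp)]
  simp

lemma attach_conjTranspose_mul_self (Φ : (∀ k, Fin (d' k)) → ℂ) :
    (attach d Φ)ᴴ * attach d Φ = (star Φ ⬝ᵥ Φ) • (1 : Op d) := by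
  ext x y
  simp only [mul_apply, conjTranspose_apply, sum_pairEquiv, attach_pairEquiv, Matrix.smul_apply,
    dotProduct, smul_eq_mul, Finset.sum_mul, Pi.star_apply]
  refine Finset.sum_congr rfl fun a _ => ?_
  rw [Finset.sum_eq_single x (fun b _ hb => by simp [hb]) (by simp)]
  simp [one_apply]

end Attach

/-! ### Partial transpose of a pure state of Schmidt rank two. -/

section Decomposition

variable {N : ℕ} {d : Fin N → ℕ}

/-- The vector `|n⟩ ⊗ A`, with `|n⟩` on the `k`-th party. -/
def slot (k : Fin N) (n : ℕ) (A : (∀ i, Fin (d i)) → ℝ) : (∀ i, Fin (d i)) → ℝ :=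
  fun x => if (x k : ℕ) = n then A x else 0

/-- For v = |0⟩A + |1⟩B, the cross term |1A⟩⟨0B| + |0B⟩⟨1A| of |v⟩⟨v|^Γ polarizes into a difference
of two squares. The weight `r` is free here; later it is chosen so that |1A⟩ and r|0B⟩ have equal
length, which makes the two squared vectors orthogonal. -/
lemma swap_decomposition {k : Fin N} {A B : (∀ i, Fin (d i)) → ℝ}
    (hA : ∀ a t, A (Function.update a k t) = A a) (hB : ∀ a t, B (Function.update a k t) = B a)
    {r : ℝ} (hr : r ≠ 0) (a b : ∀ i, Fin (d i)) :
    (slot k 0 A + slot k 1 B) (Function.update a k (b k)) *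
        (slot k 0 A + slot k 1 B) (Function.update b k (a k)) =
      slot k 0 A a * slot k 0 A b + slot k 1 B a * slot k 1 B b +
        (2 * r)⁻¹ * ((slot k 1 A + r • slot k 0 B) a * (slot k 1 A + r • slot k 0 B) b -
          (slot k 1 A - r • slot k 0 B) a * (slot k 1 A - r • slot k 0 B) b) := by
  simp only [slot, Pi.add_apply, Pi.sub_apply, Pi.smul_apply, Function.update_self, hA, hB,
    smul_eq_mul]
  field_simp
  split_ifs <;> first | omega | ring

/-- The real vector `u`, as a complex vector. -/
def cvec {ι : Type*} (u : ι → ℝ) : ι → ℂ := fun a => (u a : ℂ)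

/-- V†MV contracts M with |Φ⟩⟨Φ|. Transposing the whole composite party in M is undone by
transposing Φ as well, so the left side contracts M^Γ with |Φ⟩⟨Φ|^Γ, to which `swap_decomposition`
applies. -/
lemma partialTranspose_attach {d' : Fin N → ℕ} {k : Fin N} {A B : (∀ i, Fin (d' i)) → ℝ}
    (hA : ∀ a t, A (Function.update a k t) = A a) (hB : ∀ a t, B (Function.update a k t) = B a)
    {r : ℝ} (hr : r ≠ 0) (M : Op fun k => d' k * d k) :
    partialTranspose k ((attach d (cvec (slot k 0 A + slot k 1 B)))ᴴ * M *
        attach d (cvec (slot k 0 A + slot k 1 B))) =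
      (attach d (cvec (slot k 0 A)))ᴴ * partialTranspose k M * attach d (cvec (slot k 0 A)) +
      (attach d (cvec (slot k 1 B)))ᴴ * partialTranspose k M * attach d (cvec (slot k 1 B)) +
      (((2 * r)⁻¹ : ℝ) : ℂ) • (
        (attach d (cvec (slot k 1 A + r • slot k 0 B)))ᴴ * partialTranspose k M *
          attach d (cvec (slot k 1 A + r • slot k 0 B)) -
        (attach d (cvec (slot k 1 A - r • slot k 0 B)))ᴴ * partialTranspose k M *
          attach d (cvec (slot k 1 A - r • slot k 0 B))) := by
  ext x y
  simp only [Matrix.add_apply, Matrix.sub_apply, Matrix.smul_apply, smul_eq_mul]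
  rw [partialTranspose, of_apply]
  simp only [attach_conj_apply]
  rw [← sum_sum_swapAt k]
  simp only [← Finset.sum_add_distrib, ← Finset.sum_sub_distrib, Finset.mul_sum]
  refine Finset.sum_congr rfl fun a _ => Finset.sum_congr rfl fun b _ => ?_
  rw [partialTranspose, of_apply, update_pairEquiv, update_pairEquiv]
  have h := congrArg (Complex.ofReal) (swap_decomposition hA hB hr a b)
  simp only [Complex.ofReal_mul, Complex.ofReal_add, Complex.ofReal_sub] at h
  simp only [cvec, Complex.star_def, Complex.conj_ofReal]
  linear_combination
    M (pairEquiv d' d (Function.update a k (b k), Function.update x k (y k)))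
      (pairEquiv d' d (Function.update b k (a k), Function.update y k (x k))) * h

lemma partialTranspose_vecMulVec {k : Fin N} {A B : (∀ i, Fin (d i)) → ℝ}
    (hA : ∀ a t, A (Function.update a k t) = A a) (hB : ∀ a t, B (Function.update a k t) = B a)
    {r : ℝ} (hr : r ≠ 0) (t : (∀ i, Fin (d i)) → ℝ) :
    star (cvec t) ⬝ᵥ partialTranspose k (vecMulVec (cvec (slot k 0 A + slot k 1 B))
        (star (cvec (slot k 0 A + slot k 1 B)))) *ᵥ cvec t =
      (((t ⬝ᵥ slot k 0 A) ^ 2 + (t ⬝ᵥ slot k 1 B) ^ 2 + (2 * r)⁻¹ *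
        ((t ⬝ᵥ (slot k 1 A + r • slot k 0 B)) ^ 2 - (t ⬝ᵥ (slot k 1 A - r • slot k 0 B)) ^ 2) :
          ℝ) : ℂ) := by
  have h1 : star (cvec t) ⬝ᵥ partialTranspose k (vecMulVec (cvec (slot k 0 A + slot k 1 B))
        (star (cvec (slot k 0 A + slot k 1 B)))) *ᵥ cvec t =
      ((∑ a, ∑ b, t a * ((slot k 0 A + slot k 1 B) (Function.update a k (b k)) *
        (slot k 0 A + slot k 1 B) (Function.update b k (a k))) * t b : ℝ) : ℂ) := by
    simp only [dotProduct, mulVec, partialTranspose, of_apply, vecMulVec_apply, Pi.star_apply, cvec,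
      Complex.star_def, Complex.conj_ofReal, Finset.mul_sum, Complex.ofReal_sum, Complex.ofReal_mul,
      mul_assoc]
  rw [h1]
  congr 1
  have hsq (u : (∀ i, Fin (d i)) → ℝ) : (t ⬝ᵥ u) ^ 2 = ∑ a, ∑ b, t a * (u a * u b) * t b := by
    rw [sq, dotProduct, Finset.sum_mul_sum]
    exact Finset.sum_congr rfl fun a _ => Finset.sum_congr rfl fun b _ => by ring
  simp only [swap_decomposition hA hB hr, hsq, Finset.mul_sum,
    ← Finset.sum_add_distrib, ← Finset.sum_sub_distrib]
  exact Finset.sum_congr rfl fun a _ => Finset.sum_congr rfl fun b _ => by ring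

end Decomposition

/-! ### Positive semidefinite matrices. -/

section Positivity

variable {n : Type*} [Fintype n]

lemma re_star_dotProduct_self (u : n → ℂ) : (star u ⬝ᵥ u).re = ∑ i, ‖u i‖ ^ 2 := by
  simp [dotProduct, ← Complex.normSq_eq_norm_sq, Complex.normSq_apply]

open scoped MatrixOrder Matrix.Norms.L2Operator in
-- Write G = B†B and apply Cauchy–Schwarz to each row of B.
lemma quadraticForm_le_trace {G : Matrix n n ℂ} (hG : G.PosSemidef) {t : n → ℂ}
    (ht : star t ⬝ᵥ t = 1) : (star t ⬝ᵥ G *ᵥ t).re ≤ G.trace.re := by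
  classical
  obtain ⟨B, rfl⟩ := CStarAlgebra.nonneg_iff_eq_star_mul_self.mp hG.nonneg
  have ht' : ∑ j, ‖t j‖ ^ 2 = 1 := by
    rw [← re_star_dotProduct_self, ht, Complex.one_re]
  have h1 : (star t ⬝ᵥ (star B * B) *ᵥ t).re = ∑ i, ‖∑ j, B i j * t j‖ ^ 2 := by
    rw [star_eq_conjTranspose, ← mulVec_mulVec, dotProduct_mulVec, ← star_mulVec,
      re_star_dotProduct_self]
    rfl
  have h2 : (star B * B).trace.re = ∑ i, ∑ j, ‖B i j‖ ^ 2 := by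
    rw [Finset.sum_comm]
    simp [trace, mul_apply, star_eq_conjTranspose, ← Complex.normSq_eq_norm_sq,
      Complex.normSq_apply]
  rw [h1, h2]
  refine Finset.sum_le_sum fun i _ => ?_
  calc ‖∑ j, B i j * t j‖ ^ 2 ≤ (∑ j, ‖B i j‖ * ‖t j‖) ^ 2 := by
        gcongr
        exact (norm_sum_le _ _).trans_eq (by simp)
    _ ≤ (∑ j, ‖B i j‖ ^ 2) * ∑ j, ‖t j‖ ^ 2 := Finset.sum_mul_sq_le_sq_mul_sq _ _ _
    _ = ∑ j, ‖B i j‖ ^ 2 := by rw [ht', mul_one]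

/-- If `0 ≤ E ≤ 1` accepts the unit basis vector `b i` with certainty and never accepts another basis
vector, then `E` is the projection onto `b i`. -/
lemma eq_vecMulVec_of_identifies {ι : Type*} [DecidableEq n] (b : Module.Basis ι ℂ (n → ℂ)) {i : ι}
    {E : Matrix n n ℂ} (h0 : E.PosSemidef) (h1 : (1 - E).PosSemidef) (hu : star (b i) ⬝ᵥ b i = 1)
    (hi : star (b i) ⬝ᵥ E *ᵥ b i = 1) (hj : ∀ j ≠ i, star (b j) ⬝ᵥ E *ᵥ b j = 0) :
    E = vecMulVec (b i) (star (b i)) := by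
  have hEj (j : ι) (h : j ≠ i) : E *ᵥ b j = 0 := (h0.dotProduct_mulVec_zero_iff _).1 (hj j h)
  have hEi : E *ᵥ b i = b i := by
    have : (1 - E) *ᵥ b i = 0 := by
      rw [← h1.dotProduct_mulVec_zero_iff, sub_mulVec, one_mulVec, dotProduct_sub, hu, hi, sub_self]
    rw [sub_mulVec, one_mulVec, sub_eq_zero] at this
    exact this.symm
  apply Matrix.toLin'.injective
  refine b.ext fun j => ?_
  rw [toLin'_apply, toLin'_apply, vecMulVec_mulVec]
  by_cases h : j = i
  · subst h
    rw [hEi, hu]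
    simp
  -- Orthogonality of the basis vectors comes from E being Hermitian with eigenvalue 1 at `b i` and
  -- 0 at `b j`.
  · have : star (b i) ⬝ᵥ b j = 0 := by
      calc star (b i) ⬝ᵥ b j = star (E *ᵥ b i) ⬝ᵥ b j := by rw [hEi]
        _ = star (b i) ⬝ᵥ E *ᵥ b j := by
          rw [star_mulVec, h0.1.eq, ← dotProduct_mulVec]
        _ = 0 := by rw [hEj j h, dotProduct_zero]
    rw [hEj j h, this]
    simp

end Positivity

/-! ### Negativity of GHZ, W and the resource. -/

section ThreeParties

/-- Partial transposition of the pure state `ψ` on the second party produces the expectation value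
`-c` in some unit vector. -/
def HasNegativity (ψ : (∀ k, Fin (qubits k)) → ℂ) (c : ℝ) : Prop :=
  ∃ t : (∀ k, Fin (qubits k)) → ℂ, star t ⬝ᵥ t = 1 ∧
    star t ⬝ᵥ partialTranspose (d := qubits) 1 (vecMulVec ψ (star ψ)) *ᵥ t = ((-c : ℝ) : ℂ)

/-- A local unitary on the state becomes a unitary conjugation of its partial transpose, which
carries the witness `t` along. -/
lemma HasNegativity.localUnitary {ψ φ : Sys qubits} {c : ℝ} (h : HasNegativity ψ.ofLp c)
    (hφ : LocalUnitaryEquiv ψ φ) : HasNegativity φ.ofLp c := by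
  obtain ⟨t, ht, htc⟩ := h
  obtain ⟨U, hU, hUφ⟩ := hφ
  set T : Op qubits := tensorOp (d := qubits) (e := qubits) U with hT
  have hstar : vecMulVec φ.ofLp (star φ.ofLp) =
      (tensorOp (d := qubits) (e := qubits) fun k => (U k)ᴴ)ᴴ * vecMulVec ψ.ofLp (star ψ.ofLp) *
        tensorOp (d := qubits) (e := qubits) fun k => (U k)ᴴ := by
    rw [← conjTranspose_tensorOp, conjTranspose_conjTranspose, hUφ, star_mulVec, ← hT,
      mul_vecMulVec, vecMulVec_mul]
  set C : Op qubits := tensorOp (conjAt (d := qubits) (e := qubits) 1 fun k => (U k)ᴴ) with hC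
  have hCC : Cᴴ * C = 1 := conjAt_unitary (d := qubits) fun k => by
    rw [conjTranspose_conjTranspose]
    exact (mem_unitaryGroup_iff.1 (hU k))
  have hCC' : C * Cᴴ = 1 := mul_eq_one_comm.1 hCC
  have hCt (v) : C *ᵥ Cᴴ *ᵥ v = v := by rw [mulVec_mulVec, hCC', one_mulVec]
  refine ⟨Cᴴ *ᵥ t, ?_, ?_⟩
  · rw [star_mulVec, conjTranspose_conjTranspose, ← dotProduct_mulVec, hCt, ht]
  · rw [hstar, partialTranspose_conj, ← hC, ← mulVec_mulVec, hCt, ← mulVec_mulVec,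
      star_mulVec, conjTranspose_conjTranspose, ← dotProduct_mulVec, hCt, htc]

lemma slot_dotProduct_slot {N : ℕ} {d : Fin N → ℕ} {k : Fin N} {m n : ℕ} (h : m ≠ n)
    (A B : (∀ i, Fin (d i)) → ℝ) : slot k m A ⬝ᵥ slot k n B = 0 := by
  refine Finset.sum_eq_zero fun x _ => ?_
  simp only [slot]
  split_ifs <;> first | omega | simp

lemma slot_dotProduct_slot_of_disjoint {N : ℕ} {d : Fin N → ℕ} (k : Fin N) (m n : ℕ)
    {A B : (∀ i, Fin (d i)) → ℝ} (h : ∀ a, A a * B a = 0) : slot k m A ⬝ᵥ slot k n B = 0 := by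
  refine Finset.sum_eq_zero fun x _ => ?_
  simp only [slot]
  split_ifs <;> simp [h]

/-- The witness is the normalized minus vector of `swap_decomposition`. By `hAc` and `hBc` it is
orthogonal to the plus vector, by `hAB` to |0A⟩ and |1B⟩; its squared norm before normalization is
2c, so the value is -(2r)⁻¹·2c = -c/r. -/
lemma hasNegativity_slot {A B : (∀ k, Fin (qubits k)) → ℝ}
    (hA : ∀ a t, A (Function.update a 1 t) = A a) (hB : ∀ a t, B (Function.update a 1 t) = B a)
    (hAB : ∀ a, A a * B a = 0) {r c : ℝ} (hr : r ≠ 0) (hc : 0 < c)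
    (hAc : slot 1 1 A ⬝ᵥ slot 1 1 A = c) (hBc : r ^ 2 * (slot 1 0 B ⬝ᵥ slot 1 0 B) = c) :
    HasNegativity (cvec (slot 1 0 A + slot 1 1 B)) (c / r) := by
  have hBA : ∀ a, B a * A a = 0 := fun a => by rw [mul_comm, hAB]
  set t := (√(2 * c))⁻¹ • (slot 1 1 A - r • slot 1 0 B) with ht
  have hs : (√(2 * c))⁻¹ ^ 2 = (2 * c)⁻¹ := by rw [inv_pow, Real.sq_sqrt (by positivity)]
  have h1 : t ⬝ᵥ slot 1 0 A = 0 := by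
    simp [ht, slot_dotProduct_slot, slot_dotProduct_slot_of_disjoint _ _ _ hBA]
  have h2 : t ⬝ᵥ slot 1 1 B = 0 := by
    simp [ht, slot_dotProduct_slot, slot_dotProduct_slot_of_disjoint _ _ _ hAB]
  have h3 : t ⬝ᵥ (slot 1 1 A + r • slot 1 0 B) = 0 := by
    simp only [ht, smul_dotProduct, sub_dotProduct, dotProduct_add, dotProduct_smul, hAc,
      slot_dotProduct_slot (one_ne_zero), slot_dotProduct_slot (zero_ne_one), smul_eq_mul]
    linear_combination -(√(2 * c))⁻¹ * hBc
  have h4 : (slot 1 1 A - r • slot 1 0 B) ⬝ᵥ (slot 1 1 A - r • slot 1 0 B) = 2 * c := by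
    simp only [smul_dotProduct, sub_dotProduct, dotProduct_sub, dotProduct_smul, hAc,
      slot_dotProduct_slot (one_ne_zero), slot_dotProduct_slot (zero_ne_one), smul_eq_mul]
    linear_combination hBc
  have h5 : t ⬝ᵥ t = 1 := by
    rw [ht, smul_dotProduct, dotProduct_smul, h4, smul_smul, ← sq, hs, smul_eq_mul,
      inv_mul_cancel₀ (by positivity)]
  refine ⟨cvec t, ?_, ?_⟩
  · rw [← Complex.ofReal_one, ← h5]
    simp [dotProduct, cvec]
  · rw [partialTranspose_vecMulVec hA hB hr, h1, h2, h3]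
    congr 1
    rw [ht, smul_dotProduct, h4, smul_eq_mul, mul_pow, hs]
    field_simp
    ring

/-- The vector `|m n⟩` of the first and third parties. -/
def outer {d : Fin 3 → ℕ} (m n : ℕ) (x : ∀ k, Fin (d k)) : ℝ :=
  if (x 0 : ℕ) = m ∧ (x 2 : ℕ) = n then 1 else 0

lemma outer_update {d : Fin 3 → ℕ} (m n : ℕ) (a : ∀ k, Fin (d k)) (t : Fin (d 1)) :
    outer m n (Function.update a 1 t) = outer m n a := by
  simp [outer]

lemma outer_mul_outer {d : Fin 3 → ℕ} {m n m' n' : ℕ} (h : ¬ (m = m' ∧ n = n'))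
    (a : ∀ k, Fin (d k)) : outer m n a * outer m' n' a = 0 := by
  simp only [outer]
  split_ifs <;> first | omega | simp

lemma ket_eq_slot {d : Fin 3 → ℕ} (l m n : ℕ) :
    (ket d ![l, m, n]).ofLp = cvec (slot 1 m (outer l n)) := by
  funext x
  simp only [ket, cvec, slot, outer, Fin.forall_fin_succ, Fin.succ_zero_eq_one, Fin.succ_one_eq_two,
    IsEmpty.forall_iff, and_true]
  simp only [cons_val_zero, cons_val_one, cons_val]
  by_cases h0 : (x 0 : ℕ) = l <;> by_cases h1 : (x 1 : ℕ) = m <;>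
    by_cases h2 : (x 2 : ℕ) = n <;> simp [h0, h1, h2]

lemma cvec_add {ι : Type*} (u v : ι → ℝ) : cvec (u + v) = cvec u + cvec v := by
  funext x; simp [cvec]

lemma cvec_smul {ι : Type*} (c : ℝ) (u : ι → ℝ) : cvec (c • u) = (c : ℂ) • cvec u := by
  funext x; simp [cvec]

lemma slot_add {N : ℕ} {d : Fin N → ℕ} (k : Fin N) (n : ℕ) (A B : (∀ i, Fin (d i)) → ℝ) :
    slot k n (A + B) = slot k n A + slot k n B := by
  funext x
  simp only [slot, Pi.add_apply]
  split_ifs <;> simp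

lemma slot_smul {N : ℕ} {d : Fin N → ℕ} (k : Fin N) (n : ℕ) (c : ℝ) (A : (∀ i, Fin (d i)) → ℝ) :
    slot k n (c • A) = c • slot k n A := by
  funext x
  simp only [slot, Pi.smul_apply]
  split_ifs <;> simp

lemma GHZ_eq_slot : GHZ.ofLp = cvec (slot 1 0 ((√2)⁻¹ • outer 0 0) +
    slot 1 1 ((√2)⁻¹ • outer 1 1)) := by
  simp only [slot_smul, cvec_add, cvec_smul, ← ket_eq_slot, GHZ, WithLp.ofLp_smul, WithLp.ofLp_add,
    smul_add, Complex.ofReal_inv]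

lemma W_eq_slot : W.ofLp = cvec (slot 1 0 ((√3)⁻¹ • (outer 1 0 + outer 0 1)) +
    slot 1 1 ((√3)⁻¹ • outer 0 0)) := by
  simp only [slot_smul, slot_add, cvec_add, cvec_smul, ← ket_eq_slot, W, WithLp.ofLp_smul,
    WithLp.ofLp_add, smul_add, Complex.ofReal_inv]
  abel

lemma resource_eq_slot : resource.ofLp = cvec (slot 1 0 ((√3)⁻¹ • (outer 0 0 + outer 2 1)) +
    slot 1 1 ((√3)⁻¹ • outer 1 0)) := by
  simp only [slot_smul, slot_add, cvec_add, cvec_smul, ← ket_eq_slot, resource, WithLp.ofLp_smul,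
    WithLp.ofLp_add, smul_add, Complex.ofReal_inv]
  abel

lemma slot_outer_dotProduct_self {d : Fin 3 → ℕ} {l m n : ℕ} (hl : l < d 0) (hm : m < d 1)
    (hn : n < d 2) : slot (d := d) 1 m (outer l n) ⬝ᵥ slot 1 m (outer l n) = 1 := by
  rw [dotProduct, Finset.sum_eq_single (Fin.cons ⟨l, hl⟩ (Fin.cons ⟨m, hm⟩ (Fin.cons ⟨n, hn⟩
    finZeroElim)))]
  · have : ∀ x : ∀ k, Fin (d k), (x 0 : ℕ) = l → (x 1 : ℕ) = m → (x 2 : ℕ) = n →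
        slot 1 m (outer l n) x * slot 1 m (outer l n) x = 1 := by
      intro x h0 h1 h2
      simp [slot, outer, h0, h1, h2]
    exact this _ rfl rfl rfl
  · intro x _ hx
    by_contra h
    apply hx
    simp only [slot, outer, mul_self_eq_zero, ite_eq_right_iff, not_forall] at h
    obtain ⟨h1, ⟨h0, h2⟩, -⟩ := h
    funext k
    fin_cases k
    · exact Fin.ext h0
    · exact Fin.ext h1
    · exact Fin.ext h2
  · simp

lemma slot_outer_dotProduct_ne {d : Fin 3 → ℕ} {l m n l' n' : ℕ} (h : ¬ (l = l' ∧ n = n')) :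
    slot (d := d) 1 m (outer l n) ⬝ᵥ slot 1 m (outer l' n') = 0 :=
  slot_dotProduct_slot_of_disjoint _ _ _ (outer_mul_outer h)

lemma hasNegativity_GHZ : HasNegativity GHZ.ofLp (1 / 2) := by
  rw [GHZ_eq_slot, ← div_one (1 / 2 : ℝ)]
  have h2 : (√2)⁻¹ * (√2)⁻¹ = (1 / 2 : ℝ) := by
    rw [← mul_inv, Real.mul_self_sqrt (by norm_num)]; norm_num
  refine hasNegativity_slot ?_ ?_ ?_ one_ne_zero (by norm_num) ?_ ?_
  · intro a t; simp [outer_update]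
  · intro a t; simp [outer_update]
  · intro a
    simp only [Pi.smul_apply, smul_eq_mul]
    linear_combination (√2)⁻¹ * (√2)⁻¹ *
      outer_mul_outer (d := qubits) (by omega : ¬ (0 = 1 ∧ 0 = 1)) a
  · simp only [slot_smul, smul_dotProduct, dotProduct_smul]
    rw [slot_outer_dotProduct_self (by simp) (by simp) (by simp)]
    simp [h2]
  · simp only [slot_smul, smul_dotProduct, dotProduct_smul]
    rw [slot_outer_dotProduct_self (by simp) (by simp) (by simp)]
    simp [h2]

lemma hasNegativity_W : HasNegativity W.ofLp (√2 / 3) := by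
  have h3 : (√3)⁻¹ * (√3)⁻¹ = (1 / 3 : ℝ) := by
    rw [← mul_inv, Real.mul_self_sqrt (by norm_num)]; norm_num
  have h2 : √2 / 3 = (2 / 3) / √2 := by
    field_simp
    rw [Real.sq_sqrt (by norm_num)]
  rw [W_eq_slot, h2]
  refine hasNegativity_slot ?_ ?_ ?_ (by positivity) (by norm_num) ?_ ?_
  · intro a t; simp [outer_update]
  · intro a t; simp [outer_update]
  · intro a
    simp only [Pi.smul_apply, Pi.add_apply, smul_eq_mul]
    linear_combination (√3)⁻¹ * (√3)⁻¹ * outer_mul_outer (d := qubits) (by omega : ¬ (1 = 0 ∧ 0 = 0)) a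
      + (√3)⁻¹ * (√3)⁻¹ * outer_mul_outer (d := qubits) (by omega : ¬ (0 = 0 ∧ 1 = 0)) a
  · simp only [slot_smul, slot_add, smul_dotProduct, dotProduct_smul, add_dotProduct,
      dotProduct_add]
    rw [slot_outer_dotProduct_self (by simp) (by simp) (by simp),
      slot_outer_dotProduct_self (by simp) (by simp) (by simp),
      slot_outer_dotProduct_ne (by omega), slot_outer_dotProduct_ne (by omega)]
    simp only [smul_eq_mul]
    linear_combination 2 * h3
  · simp only [slot_smul, smul_dotProduct, dotProduct_smul]
    rw [slot_outer_dotProduct_self (by simp) (by simp) (by simp), Real.sq_sqrt (by norm_num)]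
    simp only [smul_eq_mul]
    linear_combination 2 * h3

/-- The vector spanning the negative part of the partial transpose of the resource. -/
noncomputable def resourceNegative : (∀ k, Fin (![3, 2, 2] k)) → ℝ :=
  slot 1 1 ((√3)⁻¹ • (outer 0 0 + outer 2 1)) - √2 • slot 1 0 ((√3)⁻¹ • outer 1 0)

lemma resourceNegative_dotProduct_self : resourceNegative ⬝ᵥ resourceNegative = 4 / 3 := by
  have h3 : (√3)⁻¹ * (√3)⁻¹ = (1 / 3 : ℝ) := by
    rw [← mul_inv, Real.mul_self_sqrt (by norm_num)]; norm_num
  have h2 : √2 * √2 = 2 := Real.mul_self_sqrt (by norm_num)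
  simp only [resourceNegative, slot_smul, slot_add, smul_dotProduct, dotProduct_smul,
    add_dotProduct, dotProduct_add, sub_dotProduct, dotProduct_sub,
    slot_dotProduct_slot (one_ne_zero), slot_dotProduct_slot (zero_ne_one)]
  rw [slot_outer_dotProduct_self (by simp) (by simp) (by simp),
    slot_outer_dotProduct_self (by simp) (by simp) (by simp),
    slot_outer_dotProduct_self (by simp) (by simp) (by simp),
    slot_outer_dotProduct_ne (by omega), slot_outer_dotProduct_ne (by omega)]
  simp only [smul_eq_mul]
  linear_combination (√3)⁻¹ * (√3)⁻¹ * h2 + 4 * h3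

lemma star_cvec_dotProduct_cvec {ι : Type*} [Fintype ι] (u v : ι → ℝ) :
    star (cvec u) ⬝ᵥ cvec v = ((u ⬝ᵥ v : ℝ) : ℂ) := by
  simp [dotProduct, cvec]

lemma resource_dotProduct_self : star resource.ofLp ⬝ᵥ resource.ofLp = 1 := by
  have h3 : (√3)⁻¹ * (√3)⁻¹ = (1 / 3 : ℝ) := by
    rw [← mul_inv, Real.mul_self_sqrt (by norm_num)]; norm_num
  rw [resource_eq_slot, star_cvec_dotProduct_cvec, ← Complex.ofReal_one]
  congr 1
  simp only [slot_smul, slot_add, smul_dotProduct, dotProduct_smul, add_dotProduct, dotProduct_add,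
    slot_dotProduct_slot (one_ne_zero), slot_dotProduct_slot (zero_ne_one)]
  rw [slot_outer_dotProduct_self (by simp) (by simp) (by simp),
    slot_outer_dotProduct_self (by simp) (by simp) (by simp),
    slot_outer_dotProduct_self (by simp) (by simp) (by simp),
    slot_outer_dotProduct_ne (by omega), slot_outer_dotProduct_ne (by omega)]
  simp only [smul_eq_mul]
  linear_combination 3 * h3

lemma W_dotProduct_self : star W.ofLp ⬝ᵥ W.ofLp = 1 := by
  have h3 : (√3)⁻¹ * (√3)⁻¹ = (1 / 3 : ℝ) := by
    rw [← mul_inv, Real.mul_self_sqrt (by norm_num)]; norm_num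
  rw [W_eq_slot, star_cvec_dotProduct_cvec, ← Complex.ofReal_one]
  congr 1
  simp only [slot_smul, slot_add, smul_dotProduct, dotProduct_smul, add_dotProduct, dotProduct_add,
    slot_dotProduct_slot (one_ne_zero), slot_dotProduct_slot (zero_ne_one)]
  rw [slot_outer_dotProduct_self (by simp) (by simp) (by simp),
    slot_outer_dotProduct_self (by simp) (by simp) (by simp),
    slot_outer_dotProduct_self (by simp) (by simp) (by simp),
    slot_outer_dotProduct_ne (by omega), slot_outer_dotProduct_ne (by omega)]
  simp only [smul_eq_mul]
  linear_combination 3 * h3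

lemma GHZ_dotProduct_self : star GHZ.ofLp ⬝ᵥ GHZ.ofLp = 1 := by
  have h2 : (√2)⁻¹ * (√2)⁻¹ = (1 / 2 : ℝ) := by
    rw [← mul_inv, Real.mul_self_sqrt (by norm_num)]; norm_num
  rw [GHZ_eq_slot, star_cvec_dotProduct_cvec, ← Complex.ofReal_one]
  congr 1
  simp only [slot_smul, smul_dotProduct, dotProduct_smul, add_dotProduct, dotProduct_add,
    slot_dotProduct_slot (one_ne_zero), slot_dotProduct_slot (zero_ne_one)]
  rw [slot_outer_dotProduct_self (by simp) (by simp) (by simp),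
    slot_outer_dotProduct_self (by simp) (by simp) (by simp)]
  simp only [smul_eq_mul]
  linear_combination 2 * h2

end ThreeParties

/-! ### Impossibility of perfect discrimination. -/

section PerfectDiscrimination

lemma LocalUnitaryEquiv.dotProduct_self {ψ φ : Sys qubits} (h : LocalUnitaryEquiv ψ φ) :
    star φ.ofLp ⬝ᵥ φ.ofLp = star ψ.ofLp ⬝ᵥ ψ.ofLp := by
  obtain ⟨U, hU, hφ⟩ := h
  have h1 : (tensorOp (d := qubits) (e := qubits) U)ᴴ *
      tensorOp (d := qubits) (e := qubits) U = 1 := by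
    rw [conjTranspose_tensorOp, tensorOp_mul, ← tensorOp_one]
    congr 1
    funext k
    exact mem_unitaryGroup_iff'.1 (hU k)
  rw [hφ, star_mulVec, ← dotProduct_mulVec, mulVec_mulVec, h1, one_mulVec]

/-- With r = √2, three of the four terms of `partialTranspose_attach` contribute nonnegatively since
M^Γ ≥ 0. The remaining one is bounded by its trace, which no longer depends on `t` and is linear in
`M`. -/
lemma negativity_attach_le {M : Op fun k => ![3, 2, 2] k * qubits k}
    (hM : (partialTranspose 1 M).PosSemidef) {t : (∀ k, Fin (qubits k)) → ℂ}
    (ht : star t ⬝ᵥ t = 1) :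
    -(star t ⬝ᵥ partialTranspose 1 ((attach qubits resource.ofLp)ᴴ * M *
        attach qubits resource.ofLp) *ᵥ t).re ≤
      (2 * √2)⁻¹ * ((attach qubits (cvec resourceNegative))ᴴ * partialTranspose 1 M *
        attach qubits (cvec resourceNegative)).trace.re := by
  have hpos (u : (∀ k, Fin (![3, 2, 2] k)) → ℂ) :
      ((attach qubits u)ᴴ * partialTranspose 1 M * attach qubits u).PosSemidef :=
    hM.conjTranspose_mul_mul_same _
  have hq (u : (∀ k, Fin (![3, 2, 2] k)) → ℂ) :
      0 ≤ (star t ⬝ᵥ ((attach qubits u)ᴴ * partialTranspose 1 M * attach qubits u) *ᵥ t).re :=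
    (Complex.le_def.1 ((hpos u).dotProduct_mulVec_nonneg t)).1
  set A : (∀ k, Fin (![3, 2, 2] k)) → ℝ := (√3)⁻¹ • (outer 0 0 + outer 2 1) with hA
  set B : (∀ k, Fin (![3, 2, 2] k)) → ℝ := (√3)⁻¹ • outer 1 0 with hB
  have hA' : ∀ a t, A (Function.update a 1 t) = A a := by
    intro a t; simp [hA, outer_update]
  have hB' : ∀ a t, B (Function.update a 1 t) = B a := by
    intro a t; simp [hB, outer_update]
  rw [resource_eq_slot, partialTranspose_attach hA' hB' (r := √2) (by positivity),
    ← resourceNegative]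
  simp only [add_mulVec, sub_mulVec, smul_mulVec, dotProduct_add, dotProduct_sub, dotProduct_smul,
    Complex.add_re, smul_eq_mul, Complex.re_ofReal_mul, Complex.sub_re]
  have h1 := hq (cvec (slot 1 0 A))
  have h2 := hq (cvec (slot 1 1 B))
  have h3 := hq (cvec (slot 1 1 A + √2 • slot 1 0 B))
  have h4 := quadraticForm_le_trace (hpos (cvec resourceNegative)) ht
  have hc : 0 ≤ (2 * √2)⁻¹ := by positivity
  have h5 := mul_le_mul_of_nonneg_left h4 hc
  have h6 := mul_nonneg hc h3
  linarith

/-- Completeness of the POVM leaves the trace of ‖`resourceNegative`‖²·1 in dimension 8, giving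
(2√2)⁻¹·(4/3)·8. -/
lemma sum_trace_resourceNegative {O : Type} [Fintype O]
    {M : O → Op fun k => ![3, 2, 2] k * qubits k} (hM : IsPPTMeasurement 1 M) :
    ∑ o, (2 * √2)⁻¹ * ((attach qubits (cvec resourceNegative))ᴴ * partialTranspose 1 (M o) *
        attach qubits (cvec resourceNegative)).trace.re = 8 * (√2 / 3) := by
  have h2 : √2 * √2 = 2 := Real.mul_self_sqrt (by norm_num)
  rw [← Finset.mul_sum, ← Complex.re_sum, ← trace_sum, ← Matrix.sum_mul, ← Matrix.mul_sum,
    ← partialTranspose_sum, hM.sum_eq_one, partialTranspose_one, Matrix.mul_one,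
    attach_conjTranspose_mul_self, star_cvec_dotProduct_cvec, resourceNegative_dotProduct_self,
    trace_smul, trace_one]
  simp only [Fintype.card_pi, Fintype.card_fin, Finset.prod_const, Finset.card_univ]
  norm_num
  field_simp
  linarith

lemma not_identifies {b : Module.Basis (Fin 8) ℂ (Sys qubits)}
    (hb : ∀ i, IsWState (b i) ∨ IsGHZState (b i)) (hG : ∃ i, IsGHZState (b i))
    {M : Option (Fin 8) → Op fun k => ![3, 2, 2] k * qubits k} (hM : IsPPTMeasurement 1 M) :
    ¬ Identifies M (fun i => tensorState resource (b i)) (fun _ => 1) := by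
  intro hI
  set V := attach qubits resource.ofLp with hV
  let b' : Module.Basis (Fin 8) ℂ ((∀ k, Fin (qubits k)) → ℂ) :=
    b.map (WithLp.linearEquiv 2 ℂ _)
  have hb' (i) : b' i = (b i).ofLp := rfl
  have hu (i) : star (b' i) ⬝ᵥ b' i = 1 := by
    rw [hb']
    rcases hb i with h | h
    · rw [h.dotProduct_self, W_dotProduct_self]
    · rw [h.dotProduct_self, GHZ_dotProduct_self]
  have hE (i j) : star (b' j) ⬝ᵥ (Vᴴ * M (some i) * V) *ᵥ b' j = if i = j then 1 else 0 := by
    have := hI i j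
    simp only [expect, Complex.ofReal_one, ← attach_mulVec] at this
    rw [← this, ← mulVec_mulVec, ← mulVec_mulVec, dotProduct_mulVec, ← star_mulVec, hb', hV]
  have hproj (i) : Vᴴ * M (some i) * V = vecMulVec (b i).ofLp (star (b i).ofLp) := by
    refine eq_vecMulVec_of_identifies b' ((hM.posSemidef _).conjTranspose_mul_mul_same _) ?_ (hu i)
      (by simp [hE]) (fun j hj => by simp [hE, hj.symm])
    have : 1 - Vᴴ * M (some i) * V = ∑ o ∈ Finset.univ.erase (some i), Vᴴ * M o * V := by
      rw [sub_eq_iff_eq_add', Finset.add_sum_erase _ (fun o => Vᴴ * M o * V) (Finset.mem_univ _),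
        ← Matrix.sum_mul, ← Matrix.mul_sum, hM.sum_eq_one, Matrix.mul_one, hV,
        attach_conjTranspose_mul_self, resource_dotProduct_self, one_smul]
    rw [this]
    exact posSemidef_sum _ fun o _ => (hM.posSemidef _).conjTranspose_mul_mul_same _
  set T : Option (Fin 8) → ℝ := fun o => (2 * √2)⁻¹ *
    ((attach qubits (cvec resourceNegative))ᴴ * partialTranspose 1 (M o) *
        attach qubits (cvec resourceNegative)).trace.re with hT
  have hle {i : Fin 8} {c : ℝ} (hc : HasNegativity (b i).ofLp c) : c ≤ T (some i) := by
    obtain ⟨t, ht, htc⟩ := hc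
    have := negativity_attach_le (hM.ppt (some i)) ht
    rw [← hV, hproj, htc, Complex.ofReal_re, neg_neg] at this
    exact this
  have hlt : √2 / 3 < 1 / 2 := by
    have : √2 < 3 / 2 := by
      rw [Real.sqrt_lt' (by norm_num)]; norm_num
    linarith
  have hGle {i} (h : IsGHZState (b i)) : 1 / 2 ≤ T (some i) := hle (hasNegativity_GHZ.localUnitary h)
  have hall (i) : √2 / 3 ≤ T (some i) := by
    rcases hb i with h | h
    · exact hle (hasNegativity_W.localUnitary h)
    · exact hlt.le.trans (hGle h)
  -- The inconclusive outcome can only consume part of the total.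
  have h0 : 0 ≤ T none :=
    mul_nonneg (by positivity)
      (Complex.le_def.1 ((hM.ppt none).conjTranspose_mul_mul_same _).trace_nonneg).1
  obtain ⟨i, hi⟩ := hG
  have hsum : ∑ i : Fin 8, √2 / 3 < ∑ i, T (some i) :=
    Finset.sum_lt_sum (fun i _ => hall i) ⟨i, Finset.mem_univ _, hlt.trans_le (hGle hi)⟩
  have htot := sum_trace_resourceNegative hM
  rw [← hT, Fintype.sum_option] at htot
  simp at hsum
  linarith

end PerfectDiscrimination

/-! ### An orthonormal basis of GHZ states. -/

section GHZBasis

/-- The (unnormalized) vectors of the `GHZ` basis. -/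
def ghzVector (s x : ∀ k, Fin (qubits k)) : ℤ :=
  if x 0 = 0 then (if x 1 = s 1 ∧ x 2 = s 2 then 1 else 0)
  else if x 1 = 1 + s 1 ∧ x 2 = 1 + s 2 then (if s 0 = 0 then 1 else -1) else 0

/-- Integer coefficients make the 64 inner products decidable by evaluation. -/
lemma sum_ghzVector_mul : ∀ s s' : ∀ k, Fin (qubits k),
    ∑ x, ghzVector s x * ghzVector s' x = if s = s' then 2 else 0 := by
  decide +kernel

/-- The `GHZ` basis. -/
noncomputable def ghzBasis (s : ∀ k, Fin (qubits k)) : Sys qubits :=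
  WithLp.toLp 2 fun x => ((√2)⁻¹ : ℝ) * (ghzVector s x : ℂ)

lemma orthonormal_ghzBasis : Orthonormal ℂ ghzBasis := by
  rw [orthonormal_iff_ite]
  intro s s'
  have h2 : (√2)⁻¹ * (√2)⁻¹ = (1 / 2 : ℝ) := by
    rw [← mul_inv, Real.mul_self_sqrt (by norm_num)]; norm_num
  have h : inner ℂ (ghzBasis s) (ghzBasis s') =
      (((√2)⁻¹ * (√2)⁻¹ : ℝ) : ℂ) * ((∑ x, ghzVector s x * ghzVector s' x : ℤ) : ℂ) := by
    rw [PiLp.inner_apply, Int.cast_sum, Finset.mul_sum]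
    refine Finset.sum_congr rfl fun x _ => ?_
    simp only [ghzBasis, RCLike.inner_apply, map_mul, Complex.conj_ofReal, map_intCast]
    push_cast
    ring
  rw [h, h2, sum_ghzVector_mul]
  split_ifs <;> norm_num

/-- The local unitaries that generate the `GHZ` basis. -/
def ghzUnitary (s : ∀ k, Fin (qubits k)) (k : Fin 3) : Matrix (Fin 2) (Fin 2) ℂ :=
  -- Z^{s₀} on the first qubit and X^{sₖ} on the other two.
  if k = 0 then diagonal ![1, if s 0 = 0 then 1 else -1]
  else of fun i j => if i = j + s k then 1 else 0

lemma ghzUnitary_mem (s : ∀ k, Fin (qubits k)) (k : Fin 3) :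
    ghzUnitary s k ∈ unitaryGroup (Fin 2) ℂ := by
  rw [mem_unitaryGroup_iff]
  unfold ghzUnitary
  generalize s k = t
  generalize s 0 = u
  ext i j
  fin_cases k <;> fin_cases t <;> fin_cases u <;> fin_cases i <;> fin_cases j <;>
    simp [mul_apply, star_apply, Fin.sum_univ_two]

lemma mulVec_ket {d : Fin 3 → ℕ} (A : Op d) (a : ∀ k, Fin (d k)) :
    A *ᵥ (ket d fun k => a k).ofLp = fun x => A x a := by
  have : (ket d fun k => a k).ofLp = Pi.single a 1 := by
    funext x
    simp only [ket, Pi.single_apply, funext_iff, Fin.ext_iff]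
  rw [this, mulVec_single_one]
  rfl

lemma isGHZState_ghzBasis (s : ∀ k, Fin (qubits k)) : IsGHZState (ghzBasis s) := by
  refine ⟨ghzUnitary s, ghzUnitary_mem s, ?_⟩
  have h0 : (![0, 0, 0] : Fin 3 → ℕ) = fun k => (((fun _ => 0 : ∀ k, Fin (qubits k)) k : Fin 2) : ℕ) := by
    funext k; fin_cases k <;> rfl
  have h1 : (![1, 1, 1] : Fin 3 → ℕ) = fun k => (((fun _ => 1 : ∀ k, Fin (qubits k)) k : Fin 2) : ℕ) := by
    funext k; fin_cases k <;> rfl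
  rw [GHZ, h0, h1, WithLp.ofLp_smul, mulVec_smul, WithLp.ofLp_add, mulVec_add, mulVec_ket,
    mulVec_ket]
  funext x
  simp only [ghzBasis, Pi.smul_apply, Pi.add_apply, smul_eq_mul, tensorOp, of_apply,
    Fin.prod_univ_three, ghzUnitary, ghzVector]
  rw [Complex.ofReal_inv]
  congr 1
  generalize x 0 = x0
  generalize x 1 = x1
  generalize x 2 = x2
  generalize s 0 = s0
  generalize s 1 = s1
  generalize s 2 = s2
  fin_cases x0 <;> fin_cases s0 <;> fin_cases x1 <;> fin_cases s1 <;> fin_cases x2 <;>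
    fin_cases s2 <;> simp

end GHZBasis

section PerfectDiscrimination

lemma not_perfectlyDistinguishable {b : Module.Basis (Fin 8) ℂ (Sys qubits)}
    (hb : ∀ i, IsWState (b i) ∨ IsGHZState (b i)) (hG : ∃ i, IsGHZState (b i)) :
    ¬ PerfectlyDistinguishable (fun i => tensorState resource (b i)) := by
  rintro ⟨M, hM, hI⟩
  exact not_identifies hb hG (hM.isPPTMeasurement 1) hI

lemma not_universalPerfect : ¬ UniversalPerfect resource qubits := by
  intro h
  have hcard : Fintype.card (∀ k, Fin (qubits k)) = 8 := by simp
  let e := (Fintype.equivFinOfCardEq hcard).symm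
  have ho : Orthonormal ℂ (ghzBasis ∘ e) := orthonormal_ghzBasis.comp e e.injective
  let b := basisOfOrthonormalOfCardEqFinrank ho (by simp)
  have hb : ∀ i, b i = ghzBasis (e i) := fun i => by
    simp [b]
  refine not_perfectlyDistinguishable (b := b) (fun i => Or.inr ?_) ⟨0, ?_⟩ ?_
  · rw [hb]; exact isGHZState_ghzBasis _
  · rw [hb]; exact isGHZState_ghzBasis _
  · simp only [hb]
    exact h 8 _ ho

end PerfectDiscrimination

/-! ### Product tests and randomization as protocols. -/

section ProductTests

variable {N : ℕ} {d : Fin N → ℕ}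

/-- The product vector `a₁ ⊗ ⋯ ⊗ a_N`. -/
def productVector (a : ∀ k, Fin (d k) → ℂ) : (∀ k, Fin (d k)) → ℂ :=
  fun x => ∏ k, a k (x k)

/-- The factor that normalizes `|a⟩⟨a|` to a projection. -/
noncomputable def normFactor {n : Type*} [Fintype n] (a : n → ℂ) : ℝ := (∑ i, ‖a i‖ ^ 2)⁻¹

/-- The orthogonal projection onto the line spanned by `a`. -/
noncomputable def lineProjection {n : Type*} [Fintype n] (a : n → ℂ) : Matrix n n ℂ :=
  (normFactor a : ℂ) • vecMulVec a (star a)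

lemma normFactor_pos {n : Type*} [Fintype n] {a : n → ℂ} (ha : a ≠ 0) : 0 < normFactor a := by
  obtain ⟨i, hi⟩ := Function.ne_iff.1 ha
  exact inv_pos.2 (Finset.sum_pos' (fun _ _ => by positivity)
    ⟨i, Finset.mem_univ _, by have : a i ≠ 0 := hi; positivity⟩)

lemma conjTranspose_lineProjection {n : Type*} [Fintype n] (a : n → ℂ) :
    (lineProjection a)ᴴ = lineProjection a := by
  ext i j
  simp [lineProjection, vecMulVec_apply, mul_comm]

lemma lineProjection_mul_self {n : Type*} [Fintype n] (a : n → ℂ) :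
    lineProjection a * lineProjection a = lineProjection a := by
  have h : star a ⬝ᵥ a = ((∑ i, ‖a i‖ ^ 2 : ℝ) : ℂ) := by
    simp [dotProduct, ← Complex.normSq_eq_norm_sq, Complex.normSq_eq_conj_mul_self]
  rw [lineProjection, smul_mul_smul_comm, vecMulVec_mul_vecMulVec, h, vecMulVec_smul, smul_smul]
  congr 1
  rw [← Complex.ofReal_mul, ← Complex.ofReal_mul, normFactor]
  -- For a = 0 the factor is 0⁻¹ = 0, and both sides vanish.
  by_cases h0 : ∑ i, ‖a i‖ ^ 2 = 0
  · simp [h0]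
  · rw [mul_assoc, inv_mul_cancel₀ h0, mul_one]

lemma tensorOp_lineProjection (a : ∀ k, Fin (d k) → ℂ) :
    tensorOp (fun k => lineProjection (a k)) =
      ((∏ k, normFactor (a k) : ℝ) : ℂ) • vecMulVec (productVector a) (star (productVector a)) := by
  ext x y
  simp [tensorOp, lineProjection, vecMulVec_apply, productVector, Finset.prod_mul_distrib]

lemma expect_tensorOp_lineProjection (a : ∀ k, Fin (d k) → ℂ) (v : Sys d) :
    expect ((tensorOp fun k => lineProjection (a k))ᴴ * tensorOp fun k => lineProjection (a k)) v =
      (((∏ k, normFactor (a k)) * ‖star (productVector a) ⬝ᵥ v.ofLp‖ ^ 2 : ℝ) : ℂ) := by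
  rw [conjTranspose_tensorOp, tensorOp_mul]
  simp only [conjTranspose_lineProjection, lineProjection_mul_self]
  rw [tensorOp_lineProjection, expect, smul_mulVec, vecMulVec_mulVec, dotProduct_smul,
    Complex.ofReal_mul, smul_eq_mul, ← Complex.normSq_eq_norm_sq, Complex.normSq_eq_conj_mul_self]
  congr 1
  rw [← Complex.star_def, ← star_dotProduct, dotProduct_smul, op_smul_eq_mul]

/-- Party `k` measures the projection `P`; the protocol continues if the outcome is positive and is
inconclusive otherwise. -/
def Protocol.test {α : Type} (k : Fin N) (P : Matrix (Fin (d k)) (Fin (d k)) ℂ) (h1 : Pᴴ = P)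
    (h2 : P * P = P) (next : Protocol N (Option α) d) : Protocol N (Option α) d :=
  .round k 2 (fun _ => d) (fun j => Function.update (fun _ => 1) k (![P, 1 - P] j))
    (by simp [Fin.sum_univ_two, h1, h2, mul_sub, sub_mul])
    (fun j i hi => by simp [hi]) (fun j => ![next, .announce none] j)

lemma Protocol.effect_test {α : Type} [DecidableEq α] (k : Fin N)
    (P : Matrix (Fin (d k)) (Fin (d k)) ℂ) (h1 : Pᴴ = P) (h2 : P * P = P)
    (next : Protocol N (Option α) d) (o : α) :
    (Protocol.test k P h1 h2 next).effect (some o) =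
      (tensorOp (Function.update (fun _ => 1) k P))ᴴ * next.effect (some o) *
        tensorOp (Function.update (fun _ => 1) k P) := by
  simp [Protocol.test, Protocol.effect, Fin.sum_univ_two]

/-- Party `k` chooses one of `n` protocols uniformly at random. -/
noncomputable def Protocol.randomize {O : Type} (k : Fin N) {n : ℕ} (hn : n ≠ 0)
    (next : Fin n → Protocol N O d) : Protocol N O d :=
  .round k n (fun _ => d)
    (fun _ => Function.update (fun _ => 1) k ((((√n)⁻¹ : ℝ) : ℂ) • 1))
    (by
      have : ((n : ℂ)) ≠ 0 := by exact_mod_cast hn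
      have h : (((√n)⁻¹ : ℝ) : ℂ) * (((√n)⁻¹ : ℝ) : ℂ) = (n : ℂ)⁻¹ := by
        rw [← Complex.ofReal_mul, ← mul_inv, Real.mul_self_sqrt (by positivity)]
        simp
      simp only [Function.update_self, conjTranspose_smul, conjTranspose_one, smul_mul_smul_comm,
        mul_one, Complex.star_def, Complex.conj_ofReal, h, Finset.sum_const, Finset.card_univ,
        Fintype.card_fin]
      rw [← Nat.cast_smul_eq_nsmul ℂ, smul_smul, mul_inv_cancel₀ this, one_smul])
    (fun j i hi => by simp [hi]) next

lemma Protocol.effect_randomize {O : Type} [DecidableEq O] (k : Fin N) {n : ℕ} (hn : n ≠ 0)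
    (next : Fin n → Protocol N O d) (o : O) :
    (Protocol.randomize k hn next).effect o = (n : ℂ)⁻¹ • ∑ j, (next j).effect o := by
  have h : (((√n)⁻¹ : ℝ) : ℂ) * (((√n)⁻¹ : ℝ) : ℂ) = (n : ℂ)⁻¹ := by
    rw [← Complex.ofReal_mul, ← mul_inv, Real.mul_self_sqrt (by positivity)]
    simp
  have hT : tensorOp (Function.update (fun i => (1 : Matrix (Fin (d i)) (Fin (d i)) ℂ)) k
      ((((√n)⁻¹ : ℝ) : ℂ) • 1)) = (((√n)⁻¹ : ℝ) : ℂ) • (1 : Op d) := by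
    rw [← tensorOp_one]
    ext x y
    rw [tensorOp_update_apply, Matrix.smul_apply, Matrix.smul_apply, tensorOp, of_apply,
      ← Finset.mul_prod_erase _ _ (Finset.mem_univ k), smul_eq_mul, smul_eq_mul, mul_assoc]
  rw [Protocol.randomize, Protocol.effect]
  simp only [hT, conjTranspose_smul, conjTranspose_one, Complex.star_def, Complex.conj_ofReal,
    smul_mul_assoc, mul_smul_comm, one_mul, mul_one, smul_smul, h, Finset.smul_sum]

end ProductTests

/-! ### Unambiguous discrimination with the resource. -/

section UnambiguousDiscrimination

/-- The parties test in turn for the vectors `a k`, and announce `o` if all tests are positive. -/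
noncomputable def Protocol.productTest {α : Type} {d : Fin 3 → ℕ} (a : ∀ k, Fin (d k) → ℂ) (o : α) :
    Protocol 3 (Option α) d :=
  .test 0 _ (conjTranspose_lineProjection (a 0)) (lineProjection_mul_self _) <|
  .test 1 _ (conjTranspose_lineProjection (a 1)) (lineProjection_mul_self _) <|
  .test 2 _ (conjTranspose_lineProjection (a 2)) (lineProjection_mul_self _) <|
  .announce (some o)

lemma Protocol.effect_productTest {α : Type} [DecidableEq α] {d : Fin 3 → ℕ}
    (a : ∀ k, Fin (d k) → ℂ) (o o' : α) :
    (Protocol.productTest a o).effect (some o') = if o' = o then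
      (tensorOp fun k => lineProjection (a k))ᴴ * tensorOp fun k => lineProjection (a k) else 0 := by
  have h : (tensorOp fun k => lineProjection (a k)) =
      tensorOp (Function.update (fun _ => 1) 2 (lineProjection (a 2))) *
        (tensorOp (Function.update (fun _ => 1) 1 (lineProjection (a 1))) *
          tensorOp (Function.update (fun _ => 1) 0 (lineProjection (a 0)))) := by
    rw [tensorOp_mul, tensorOp_mul]
    congr 1
    funext k
    fin_cases k <;> simp [Function.update]
  rw [Protocol.productTest, Protocol.effect_test, Protocol.effect_test, Protocol.effect_test,
    Protocol.effect]
  by_cases ho : o' = o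
  · rw [if_pos ho, if_pos (congrArg some ho), h]
    simp only [conjTranspose_mul, Matrix.mul_assoc, Matrix.mul_one]
  · rw [if_neg ho, if_neg (fun h => ho (Option.some_injective _ h))]
    simp

lemma unambiguouslyDistinguishable_of_productVector {n : ℕ} {d : Fin 3 → ℕ} {χ : Fin n → Sys d}
    (a : Fin n → ∀ k, Fin (d k) → ℂ)
    (h0 : ∀ i j, i ≠ j → star (productVector (a i)) ⬝ᵥ (χ j).ofLp = 0)
    (h1 : ∀ i, star (productVector (a i)) ⬝ᵥ (χ i).ofLp ≠ 0) :
    UnambiguouslyDistinguishable χ := by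
  -- A uniform choice needs at least one branch.
  by_cases hn : n = 0
  · subst hn
    exact ⟨_, ⟨.announce none, fun _ => rfl⟩, fun _ => 1, fun i => i.elim0, fun i => i.elim0⟩
  have ha (i k) : a i k ≠ 0 := by
    intro h
    apply h1 i
    have : productVector (a i) = 0 := by
      funext x
      exact Finset.prod_eq_zero (Finset.mem_univ k) (by simp [h])
    rw [this, star_zero, zero_dotProduct]
  refine ⟨_, ⟨.randomize 0 hn fun i => .productTest (a i) i, fun _ => rfl⟩,
    fun i => (n : ℝ)⁻¹ * ((∏ k, normFactor (a i k)) *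
      ‖star (productVector (a i)) ⬝ᵥ (χ i).ofLp‖ ^ 2), fun i => ?_, fun i j => ?_⟩
  · have := h1 i
    have h2 : 0 < ∏ k, normFactor (a i k) := Finset.prod_pos fun k _ => normFactor_pos (ha i k)
    have h3 : 0 < n := Nat.pos_of_ne_zero hn
    positivity
  · rw [Protocol.effect_randomize]
    simp only [Protocol.effect_productTest, Finset.sum_ite_eq, Finset.mem_univ, if_true]
    have := expect_tensorOp_lineProjection (a i) (χ j)
    rw [expect] at this ⊢
    rw [smul_mulVec, dotProduct_smul, this]
    split_ifs with hij
    · subst hij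
      simp
    · simp [h0 i j hij]

lemma exists_quadratic_form_zero (A B C : ℂ) :
    ∃ u v : ℂ, (u ≠ 0 ∨ v ≠ 0) ∧ A * u ^ 2 + B * u * v + C * v ^ 2 = 0 := by
  by_cases hA : A = 0
  · exact ⟨1, 0, by simp [hA]⟩
  · obtain ⟨s, hs⟩ := IsAlgClosed.exists_pow_nat_eq (discrim A B C) two_pos
    obtain ⟨x, hx⟩ := exists_quadratic_eq_zero hA ⟨s, by rw [← hs, sq]⟩
    exact ⟨x, 1, by simp, by linear_combination hx⟩

lemma exists_unimodular_complement {p q : ℂ} (h : p ≠ 0 ∨ q ≠ 0) : ∃ r s, p * s - q * r = 1 := by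
  rcases h with h | h
  · exact ⟨0, p⁻¹, by simp [h]⟩
  · exact ⟨-q⁻¹, 0, by simp [h]⟩

/-- Two bilinear forms in two variables have a common isotropic pair of nonzero vectors. -/
lemma exists_common_isotropic (F : Fin 2 → Fin 2 → Fin 2 → ℂ) :
    ∃ p q u v : ℂ, (p ≠ 0 ∨ q ≠ 0) ∧ (u ≠ 0 ∨ v ≠ 0) ∧
      ∀ z, p * (F z 0 0 * u + F z 0 1 * v) + q * (F z 1 0 * u + F z 1 1 * v) = 0 := by
  -- The form is the determinant of the 2×2 matrix obtained by contracting the last index of `F`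
  -- with (u, v). At a zero of it, (p, q) is a kernel vector.
  obtain ⟨u, v, huv, h⟩ := exists_quadratic_form_zero
    (F 0 0 0 * F 1 1 0 - F 0 1 0 * F 1 0 0)
    (F 0 0 0 * F 1 1 1 + F 0 0 1 * F 1 1 0 - F 0 1 0 * F 1 0 1 - F 0 1 1 * F 1 0 0)
    (F 0 0 1 * F 1 1 1 - F 0 1 1 * F 1 0 1)
  obtain ⟨w, hw, hw'⟩ := exists_mulVec_eq_zero_iff.2
    (show (of fun z i => F z i 0 * u + F z i 1 * v : Matrix (Fin 2) (Fin 2) ℂ).det = 0 by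
      rw [det_fin_two]
      simp only [of_apply]
      linear_combination h)
  refine ⟨w 0, w 1, u, v, ?_, huv, fun z => ?_⟩
  · by_contra! hc
    apply hw
    funext i
    fin_cases i
    · exact hc.1
    · exact hc.2
  · have := congrFun hw' z
    simp only [mulVec, dotProduct, Fin.sum_univ_two, of_apply, Pi.zero_apply] at this
    linear_combination this

/-- Every tensor in `ℂ² ⊗ ℂ² ⊗ ℂ²` is a local image of the resource. -/
lemma exists_local_image (F : Fin 2 → Fin 2 → Fin 2 → ℂ) :
    ∃ β : Fin 3 → ℕ → Fin 2 → ℂ, ∀ z i j, β 0 0 z * β 1 0 i * β 2 0 j +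
      β 0 1 z * β 1 1 i * β 2 0 j + β 0 2 z * β 1 0 i * β 2 1 j = F z i j := by
  -- In the bases (r, s), (p, q) and (r', s'), (u, v), both forms `F z` lose their last coefficient.
  -- The other three match the three terms of the resource: `β 0` lists these coefficients, `β 1`
  -- and `β 2` the dual bases.
  obtain ⟨p, q, u, v, hpq, huv, h⟩ := exists_common_isotropic F
  obtain ⟨r, s, hrs⟩ := exists_unimodular_complement hpq
  obtain ⟨r', s', hrs'⟩ := exists_unimodular_complement huv
  let E (x y x' y' : ℂ) (z : Fin 2) : ℂ :=
    x * (F z 0 0 * x' + F z 0 1 * y') + y * (F z 1 0 * x' + F z 1 1 * y')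
  refine ⟨![fun y => if y = 0 then E r s r' s' else if y = 1 then E p q r' s' else E r s u v,
    fun y => if y = 0 then ![-q, p] else ![s, -r],
    fun y => if y = 0 then ![-v, u] else ![s', -r']], fun z i j => ?_⟩
  have hz := h z
  simp only [cons_val_zero, cons_val_one, cons_val, if_true, one_ne_zero, if_false,
    OfNat.ofNat_ne_zero, OfNat.ofNat_ne_one, E]
  fin_cases i <;> fin_cases j <;>
    simp only [Fin.zero_eta, Fin.mk_one, cons_val_zero, cons_val_one]
  · linear_combination (u * s' - v * r') * F z 0 0 * hrs + F z 0 0 * hrs' - s * s' * hz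
  · linear_combination (u * s' - v * r') * F z 0 1 * hrs + F z 0 1 * hrs' + s * r' * hz
  · linear_combination (u * s' - v * r') * F z 1 0 * hrs + F z 1 0 * hrs' + r * s' * hz
  · linear_combination (u * s' - v * r') * F z 1 1 * hrs + F z 1 1 * hrs' - r * r' * hz

lemma sum_ket_mul {d : Fin 3 → ℕ} {l m n : ℕ} (hl : l < d 0) (hm : m < d 1) (hn : n < d 2)
    (F : ℕ → ℕ → ℕ → ℂ) :
    ∑ x, (ket d ![l, m, n]).ofLp x * F (x 0) (x 1) (x 2) = F l m n := by
  have hk (x : ∀ k, Fin (d k)) : (ket d ![l, m, n]).ofLp x =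
      if (x 0 : ℕ) = l ∧ (x 1 : ℕ) = m ∧ (x 2 : ℕ) = n then 1 else 0 := by
    simp only [ket, Fin.forall_fin_succ, Fin.succ_zero_eq_one, Fin.succ_one_eq_two,
      IsEmpty.forall_iff, and_true]
    rfl
  simp only [hk]
  rw [Finset.sum_eq_single (Fin.cons ⟨l, hl⟩ (Fin.cons ⟨m, hm⟩ (Fin.cons ⟨n, hn⟩ finZeroElim)))]
  · have : ∀ x : ∀ k, Fin (d k), (x 0 : ℕ) = l → (x 1 : ℕ) = m → (x 2 : ℕ) = n →
        (if (x 0 : ℕ) = l ∧ (x 1 : ℕ) = m ∧ (x 2 : ℕ) = n then 1 else 0) *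
          F (x 0) (x 1) (x 2) = F l m n := by
      intro x h0 h1 h2
      simp [h0, h1, h2]
    exact this _ rfl rfl rfl
  · intro x _ hx
    rw [if_neg, zero_mul]
    rintro ⟨h0, h1, h2⟩
    apply hx
    funext k
    fin_cases k
    · exact Fin.ext h0
    · exact Fin.ext h1
    · exact Fin.ext h2
  · simp

/-- Every linear functional on three qubits is, with the resource, a product test. -/
lemma exists_productVector (f : (∀ k, Fin (qubits k)) → ℂ) :
    ∃ a : ∀ k, Fin (![3, 2, 2] k * qubits k) → ℂ, ∀ ψ : Sys qubits,
      star (productVector a) ⬝ᵥ (tensorState resource ψ).ofLp = f ⬝ᵥ ψ.ofLp := by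
  -- The factor √3 cancels the normalization of the resource.
  obtain ⟨β, hβ⟩ := exists_local_image fun z i j => √3 * f ![z, i, j]
  refine ⟨fun k x => star (β k (x.divNat : ℕ) x.modNat), fun ψ => ?_⟩
  have hsum (z : ∀ k, Fin (qubits k)) :
      ∑ y, resource.ofLp y * ∏ k, β k (y k : ℕ) (z k) = f z := by
    have hz : ![z 0, z 1, z 2] = z := by
      funext k; fin_cases k <;> rfl
    have h3 : (√3 : ℂ) ≠ 0 := by
      exact_mod_cast (Real.sqrt_pos.2 three_pos).ne'
    have := hβ (z 0) (z 1) (z 2)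
    rw [hz] at this
    simp only [resource, WithLp.ofLp_smul, WithLp.ofLp_add, Pi.smul_apply, Pi.add_apply,
      smul_eq_mul, mul_assoc, ← Finset.mul_sum, add_mul, Finset.sum_add_distrib,
      Fin.prod_univ_three]
    rw [sum_ket_mul (by simp) (by simp) (by simp)
        (fun i j l => β 0 i (z 0) * (β 1 j (z 1) * β 2 l (z 2))),
      sum_ket_mul (by simp) (by simp) (by simp)
        (fun i j l => β 0 i (z 0) * (β 1 j (z 1) * β 2 l (z 2))),
      sum_ket_mul (by simp) (by simp) (by simp)
        (fun i j l => β 0 i (z 0) * (β 1 j (z 1) * β 2 l (z 2)))]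
    field_simp
    linear_combination this
  rw [dotProduct, sum_pairEquiv, Finset.sum_comm]
  simp only [dotProduct, ← hsum, Finset.sum_mul]
  refine Finset.sum_congr rfl fun z _ => Finset.sum_congr rfl fun y _ => ?_
  have hy (k) : (pairEquiv ![3, 2, 2] qubits (y, z) k).divNat = y k :=
    congrFun (congrArg Prod.fst ((pairEquiv ![3, 2, 2] qubits).symm_apply_apply (y, z))) k
  have hz (k) : (pairEquiv ![3, 2, 2] qubits (y, z) k).modNat = z k :=
    congrFun (congrArg Prod.snd ((pairEquiv ![3, 2, 2] qubits).symm_apply_apply (y, z))) k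
  simp only [tensorState, productVector, Pi.star_apply, star_prod, star_star, hy, hz]
  ring

lemma universalUnambiguous : UniversalUnambiguous resource qubits := by
  intro n ψ _ hψ
  have hdual (i : Fin n) : ∃ f : (∀ k, Fin (qubits k)) → ℂ,
      ∀ j, f ⬝ᵥ (ψ j).ofLp = if i = j then 1 else 0 := by
    -- The `i`-th coordinate on the span of the family, extended to the whole space.
    obtain ⟨g, hg⟩ := LinearMap.exists_extend ((Finsupp.lapply i) ∘ₗ hψ.repr)
    refine ⟨fun x => g (EuclideanSpace.single x 1), fun j => ?_⟩
    have hv : ψ j = ∑ x, (ψ j) x • EuclideanSpace.single x (1 : ℂ) := by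
      ext y
      simp [Pi.single_apply]
    have h1 : g (ψ j) = if i = j then 1 else 0 := by
      have := LinearMap.congr_fun hg ⟨ψ j, Submodule.subset_span ⟨j, rfl⟩⟩
      simp only [LinearMap.comp_apply, Submodule.subtype_apply] at this
      rw [this, hψ.repr_eq_single j _ rfl, Finsupp.lapply_apply, Finsupp.single_apply]
      simp only [eq_comm]
    rw [← h1, hv, map_sum, dotProduct, ← hv]
    exact Finset.sum_congr rfl fun x _ => by rw [map_smul, smul_eq_mul, mul_comm]
  choose f hf using hdual
  choose a ha using fun i => exists_productVector (f i)
  refine unambiguouslyDistinguishable_of_productVector a (fun i j hij => ?_) (fun i => ?_)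
  · rw [ha, hf, if_neg hij]
  · rw [ha, hf, if_pos rfl]
    exact one_ne_zero

end UnambiguousDiscrimination

end LocalDiscrimination

open LocalDiscrimination in
theorem mainTheorem6 :
    UniversalUnambiguous resource qubits ∧
    ¬ UniversalPerfect resource qubits ∧
    ∀ b : Module.Basis (Fin 8) ℂ (Sys qubits),
      (∀ i, IsWState (b i) ∨ IsGHZState (b i)) → (∃ i, IsGHZState (b i)) →
        ¬ PerfectlyDistinguishable (fun i => tensorState resource (b i)) ∧
        ∀ M ∈ closure {M : Option (Fin 8) → Op (fun k => ![3, 2, 2] k * qubits k) |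
            IsLOCCMeasurement M},
          ¬ Identifies M (fun i => tensorState resource (b i)) (fun _ => 1) := by
  refine ⟨universalUnambiguous, not_universalPerfect, fun b hb hG =>
    ⟨not_perfectlyDistinguishable hb hG, fun M hM => ?_⟩⟩
  exact not_identifies hb hG (isPPTMeasurement_of_mem_closure 1 hM)
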